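/- Let $K$ be a field of characteristic zero, let $n\ge 0$ be an integer, let $P_n=K[x_1,\dots,x_n]$ (so $P_0=K$), let $D_n={\rm Der}_K(P_n)=\bigoplus_{i=1}^n P_n\partial_i$, $\partial_i=\partial/\partial x_i$, be the Lie algebra of $K$-derivations of $P_n$ with bracket $[\partial,\delta]=\partial\delta-\delta\partial$, and for $\partial=\sum_i a_i\partial_i\in D_n$ let ${\rm div}(\partial)=\sum_i \partial a_i/\partial x_i$. Let $\mathfrak{div}_n^c=\{\partial\in D_n \mid {\rm div}(\partial)\in K\}$, a Lie subalgebra of $D_n$. A Lie subalgebra $M$ of a Lie algebra $L$ is called maximal if $M\neq L$ and $L$ is the only Lie subalgebra of $L$ properly containing $M$. Then: 1. If $n\ge 2$, then $P_n/K$, with the action of $\mathfrak{div}_n^c$ induced by $\partial * p=\partial(p)$, is a simple $\mathfrak{div}_n^c$-module, and $\mathfrak{div}_n^c$ is a maximal Lie subalgebra of $D_n$. 2. $\mathfrak{div}_1^c$ is not a maximal Lie subalgebra of $D_1$. 3. For every $n$, $\varphi(\mathfrak{div}_n^c)=\mathfrak{div}_n^c$ for every automorphism $\varphi\in{\rm Aut}_{\rm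 Lie}(D_n)$ of the $K$-Lie algebra $D_n$. 4. For every $n$, $\sigma\,\mathfrak{div}_n^c\,\sigma^{-1}=\mathfrak{div}_n^c$ for every $K$-algebra automorphism $\sigma\in G_n={\rm Aut}_{K\text{-alg}}(P_n)$, which acts on $D_n$ by $\partial\mapsto\sigma\partial\sigma^{-1}$. -/

import Mathlib

namespace PolyVF

open MvPolynomial

/-- The polynomial algebra `P_n = K[x_1, …, x_n]`. -/
abbrev Poly (K : Type*) [Field K] (n : ℕ) : Type _ := MvPolynomial (Fin n) K

/-- The Lie algebra `D_n = Der_K(P_n)`, with the commutator bracket. -/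
abbrev VF (K : Type*) [Field K] (n : ℕ) : Type _ := Derivation K (Poly K n) (Poly K n)

variable {K : Type*} [Field K] {n : ℕ}

/-- The divergence `div(∂) = ∑ᵢ ∂aᵢ/∂xᵢ` of `∂ = ∑ᵢ aᵢ ∂ᵢ`, where `aᵢ = ∂(xᵢ)`. -/
noncomputable def divergence (D : VF K n) : Poly K n := ∑ i, pderiv i (D (X i))

theorem vf_eq_sum (D : VF K n) (p : Poly K n) : D p = ∑ j, D (X j) * pderiv j p := by
  have hs : ∀ q : Poly K n, (∑ j, D (X j) • (pderiv j : VF K n)) q = ∑ j, D (X j) * pderiv j q := by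
    intro q
    have h := map_sum (Derivation.coeFnAddMonoidHom : VF K n →+ (Poly K n → Poly K n))
      (fun j => D (X j) • (pderiv j : VF K n)) Finset.univ
    have h2 := congrFun h q
    rw [Finset.sum_apply] at h2
    exact h2
  have h : D = ∑ j, D (X j) • (pderiv j : VF K n) := by
    apply MvPolynomial.derivation_ext
    intro i
    rw [hs, Finset.sum_eq_single i]
    · simp
    · intro b _ hb
      rw [pderiv_X_of_ne hb.symm, mul_zero]
    · simp
  conv_lhs => rw [h]
  exact hs p

theorem pderiv_comm_vf (D : VF K n) (i : Fin n) (p : Poly K n) :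
    pderiv i (D p) = D (pderiv i p) + ∑ j, pderiv i (D (X j)) * pderiv j p := by
  have h := vf_eq_sum (⁅(pderiv i : VF K n), D⁆) p
  rw [Derivation.commutator_apply, sub_eq_iff_eq_add] at h
  rw [h, add_comm]
  congr 1
  refine Finset.sum_congr rfl fun j _ => ?_
  rw [Derivation.commutator_apply]
  rcases eq_or_ne j i with rfl | hj
  · simp
  · simp [pderiv_X_of_ne hj]

theorem divergence_lie (D E : VF K n) :
    divergence ⁅D, E⁆ = D (divergence E) - E (divergence D) := by
  simp only [divergence, Derivation.commutator_apply, map_sub, map_sum, Finset.sum_sub_distrib]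
  simp only [pderiv_comm_vf D _ (E _), pderiv_comm_vf E _ (D _), Finset.sum_add_distrib]
  have : ∑ i, ∑ j, pderiv i (D (X j)) * pderiv j (E (X i))
      = ∑ i, ∑ j, pderiv i (E (X j)) * pderiv j (D (X i)) := by
    rw [Finset.sum_comm]
    simp only [mul_comm]
  rw [this]
  ring

/-- The Lie algebra `𝔡𝔦𝔳_n^c` of polynomial vector fields with constant divergence, as a Lie
subalgebra of `D_n`. -/
noncomputable def divC (K : Type*) [Field K] (n : ℕ) : LieSubalgebra K (VF K n) where
  carrier := {D | ∃ c : K, divergence D = C c}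
  add_mem' := by
    rintro D E ⟨c, hc⟩ ⟨d, hd⟩
    refine ⟨c + d, ?_⟩
    simp only [divergence] at hc hd ⊢
    simp [Finset.sum_add_distrib, hc, hd]
  zero_mem' := ⟨0, by simp [divergence]⟩
  smul_mem' := by
    rintro a D ⟨c, hc⟩
    refine ⟨a * c, ?_⟩
    simp only [divergence] at hc ⊢
    simp [← hc, Finset.mul_sum, smul_eq_C_mul]
  lie_mem' := by
    rintro D E ⟨c, hc⟩ ⟨d, hd⟩
    exact ⟨0, by simp [divergence_lie, hc, hd]⟩

/-- The derivation `σ ∂ σ⁻¹` for `σ ∈ G_n = Aut_{K-alg}(P_n)` and `∂ ∈ D_n`. -/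
noncomputable def conjDer (σ : Poly K n ≃ₐ[K] Poly K n) (D : VF K n) : VF K n :=
  Derivation.mk' (σ.toLinearMap ∘ₗ D.toLinearMap ∘ₗ σ.symm.toLinearMap) (fun a b => by simp)

theorem conjDer_apply (σ : Poly K n ≃ₐ[K] Poly K n) (D : VF K n) (p : Poly K n) :
    conjDer σ D p = σ (D (σ.symm p)) := rfl

/-- The action of `σ ∈ G_n` on `D_n`: the Lie algebra automorphism `∂ ↦ σ ∂ σ⁻¹`. -/
noncomputable def conj (σ : Poly K n ≃ₐ[K] Poly K n) : VF K n ≃ₗ⁅K⁆ VF K n where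
  toFun := conjDer σ
  invFun := conjDer σ.symm
  map_add' D E := by apply Derivation.ext; intro p; simp [conjDer_apply]
  map_smul' a D := by apply Derivation.ext; intro p; simp [conjDer_apply]
  map_lie' {D E} := by
    apply Derivation.ext
    intro p
    simp only [Derivation.commutator_apply, conjDer_apply, map_sub, AlgEquiv.symm_apply_apply]
  left_inv D := by apply Derivation.ext; intro p; simp [conjDer_apply]
  right_inv D := by apply Derivation.ext; intro p; simp [conjDer_apply]

theorem conj_apply (σ : Poly K n ≃ₐ[K] Poly K n) (D : VF K n) (p : Poly K n) :
    conj σ D p = σ (D (σ.symm p)) := rfl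

/-- The constants `K ⊆ P_n`, a submodule of `P_n` for the natural action `∂ * p = ∂(p)` of
`𝔡𝔦𝔳_n^c`. -/
noncomputable def constants (K : Type*) [Field K] (n : ℕ) :
    LieSubmodule K (divC K n) (Poly K n) where
  toSubmodule := LinearMap.range (Algebra.linearMap K (Poly K n))
  lie_mem := by
    rintro D _ ⟨c, rfl⟩
    refine ⟨0, ?_⟩
    rw [map_zero]
    exact ((D : VF K n).map_algebraMap c).symm

theorem mem_divC {D : VF K n} : D ∈ divC K n ↔ ∃ c : K, divergence D = C c := Iff.rfl

end PolyVF

/-!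
Two facts carry the result.

*A subspace of `P_n` (`n ≥ 2`) that is stable under the vector fields of divergence zero and
contains a nonconstant polynomial is all of `P_n`* (`eq_top_of_stable`). Differentiation brings the
polynomial down to degree one, a shear `xⱼ ∂ᵢ` then produces a variable `xⱼ`, and `D xⱼ` runs
through all of `P_n` as `D` runs through the fields of divergence zero. Simplicity of `P_n / K` is
immediate. For maximality, if a Lie subalgebra `M` properly contains `divC`, then `div(M)` is such
a subspace, because `div [E, F] = E (div F)` when `div E = 0`; hence `div(M) = P_n`, and `M`
contains the kernel of the divergence. For `n = 1` the vector fields with coefficient of degree at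
most two form a Lie subalgebra strictly between `divC` and `D_1`.

*The Lie algebra `divZero` of vector fields of divergence zero is generated by the elements `D` of
`D_n` with `ad D` locally nilpotent* (`lieSpan_adNilpotents`). This description is intrinsic, so
every automorphism of `D_n` preserves `divZero`, and with it the normalizer of `divZero`, which is
`divC`. The automorphisms of `D_n` need not be classified, and conjugations by automorphisms of
`P_n` are a special case.

For one inclusion, let `ad D` be locally nilpotent. Since `(ad D)^k (f D) = (D^k f) D`, the
derivation `D` is locally nilpotent on `P_n`, hence some power of the Lie derivative along `D` kills
each `dxᵢ`, and then some power kills `dx₁ ∧ ⋯ ∧ dxₙ`; on coefficients of top forms it is the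
operator `p ↦ D p + div(D) p` (`apply_jacobian_add`). If `div(D) ≠ 0` this operator is injective,
because a
locally nilpotent derivation of a domain of characteristic zero cannot satisfy `D f = g f` with `f`
and `g` nonzero (`eq_zero_of_apply_eq_mul`). So `div(D) = 0`.

For the other inclusion, the shears `u ∂ᵢ` with `∂u/∂xᵢ = 0` have locally nilpotent adjoint action,
and brackets of two shears complete every `a ∂ᵢ` to a field `a ∂ᵢ + b ∂ⱼ` of divergence zero.
Subtracting such fields from a given field of divergence zero leaves a shear.
-/

namespace PolyVF

open MvPolynomial

/-! ### Locally nilpotent derivations -/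

section LocallyNilpotent

variable {R A : Type*} [CommRing R] [CommRing A] [Algebra R A]

theorem iterate_derivation_mul (D : Derivation R A A) (f g : A) (m : ℕ) :
    D^[m] (f * g) =
      ∑ ij ∈ Finset.HasAntidiagonal.antidiagonal m, m.choose ij.1 • (D^[ij.1] f * D^[ij.2] g) := by
  induction m with
  | zero => simp
  | succ m ih =>
    rw [Finset.sum_antidiagonal_choose_succ_nsmul (fun i j => D^[i] f * D^[j] g) m,
      Function.iterate_succ_apply', ih, map_sum, ← Finset.sum_add_distrib]
    refine Finset.sum_congr rfl fun ij hij => ?_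
    rw [Finset.HasAntidiagonal.mem_antidiagonal, add_comm] at hij
    rw [Nat.choose_symm_of_eq_add hij.symm, map_nsmul, Derivation.leibniz, ← smul_add,
      Function.iterate_succ_apply', Function.iterate_succ_apply']
    simp only [smul_eq_mul]
    ring

theorem iterate_derivation_eq_zero_of_le (D : Derivation R A A) {f : A} {k m : ℕ}
    (h : D^[k] f = 0) (hkm : k ≤ m) : D^[m] f = 0 := by
  obtain ⟨l, rfl⟩ := Nat.exists_eq_add_of_le' hkm
  rw [Function.iterate_add_apply, h, iterate_map_zero]

theorem exists_iterate_mul_eq_zero (D : Derivation R A A) {f g : A}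
    (hf : ∃ k, D^[k] f = 0) (hg : ∃ k, D^[k] g = 0) : ∃ k, D^[k] (f * g) = 0 := by
  obtain ⟨a, ha⟩ := hf
  obtain ⟨b, hb⟩ := hg
  refine ⟨a + b, ?_⟩
  rw [iterate_derivation_mul]
  refine Finset.sum_eq_zero fun ij hij => ?_
  rw [Finset.HasAntidiagonal.mem_antidiagonal] at hij
  rcases le_or_gt a ij.1 with h | h
  · rw [iterate_derivation_eq_zero_of_le D ha h, zero_mul, smul_zero]
  · rw [iterate_derivation_eq_zero_of_le D hb (by omega), mul_zero, smul_zero]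

theorem exists_iterate_ne_zero_of_ne_zero (D : Derivation R A A) {f : A} (hf : f ≠ 0)
    (h : ∃ k, D^[k] f = 0) : ∃ a, D^[a] f ≠ 0 ∧ D^[a + 1] f = 0 := by
  classical
  have hpos : Nat.find h ≠ 0 := fun h0 => hf (by simpa [h0] using Nat.find_spec h)
  refine ⟨Nat.find h - 1, Nat.find_min h (by omega), ?_⟩
  rw [Nat.sub_add_cancel (Nat.one_le_iff_ne_zero.mpr hpos)]
  exact Nat.find_spec h

/-- A locally nilpotent derivation of a domain of characteristic zero has no eigenvectors with
nonzero eigenvalue `g`, even if `g` is not a constant. If `a` and `b` are the largest exponents with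
`D^a f ≠ 0` and `D^b g ≠ 0`, then `D^(a+b) (g f)` is a nonzero multiple of `D^b g * D^a f`, whereas
`D^(a+b) (D f) = 0`. -/
theorem eq_zero_of_apply_eq_mul [IsDomain A] [CharZero A] (D : Derivation R A A)
    (hD : ∀ f, ∃ k, D^[k] f = 0) {f g : A} (h : D f = g * f) : g = 0 ∨ f = 0 := by
  by_contra! hne
  obtain ⟨b, hb, hb'⟩ := exists_iterate_ne_zero_of_ne_zero D hne.1 (hD g)
  obtain ⟨a, ha, ha'⟩ := exists_iterate_ne_zero_of_ne_zero D hne.2 (hD f)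
  have h0 : D^[b + a] (g * f) = 0 := by
    rw [← h, ← Function.iterate_succ_apply]
    exact iterate_derivation_eq_zero_of_le D ha' (by omega)
  rw [iterate_derivation_mul, Finset.sum_eq_single (b, a)] at h0
  · rw [nsmul_eq_mul] at h0
    have hc : ((b + a).choose b : A) ≠ 0 :=
      Nat.cast_ne_zero.mpr (Nat.choose_pos (Nat.le_add_right b a)).ne'
    exact mul_ne_zero hc (mul_ne_zero hb ha) h0
  · rintro ⟨i, j⟩ hij hne
    rw [Finset.HasAntidiagonal.mem_antidiagonal] at hij
    dsimp only at hij ⊢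
    rcases lt_trichotomy i b with hi | rfl | hi
    · rw [iterate_derivation_eq_zero_of_le D ha' (by omega), mul_zero, smul_zero]
    · exact absurd (by rw [Nat.add_left_cancel hij]) hne
    · rw [iterate_derivation_eq_zero_of_le D hb' (by omega), zero_mul, smul_zero]
  · simp

end LocallyNilpotent

section Determinant

variable {R A ι : Type*} [CommRing R] [CommRing A] [Algebra R A] [DecidableEq ι]

theorem derivation_prod (D : Derivation R A A) (s : Finset ι) (f : ι → A) :
    D (∏ i ∈ s, f i) = ∑ i ∈ s, ∏ j ∈ s, Function.update f i (D (f i)) j := by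
  induction s using Finset.induction_on with
  | empty => simp
  | insert a s ha ih =>
    rw [Finset.prod_insert ha, Derivation.leibniz, ih, Finset.sum_insert ha,
      Finset.prod_insert ha, Function.update_self, add_comm]
    congr 1
    · rw [smul_eq_mul, mul_comm]
      congr 1
      refine Finset.prod_congr rfl fun j hj => ?_
      rw [Function.update_of_ne (ne_of_mem_of_not_mem hj ha)]
    · rw [smul_eq_mul, Finset.mul_sum]
      refine Finset.sum_congr rfl fun i hi => ?_
      rw [Finset.prod_insert ha, Function.update_of_ne (ne_of_mem_of_not_mem hi ha).symm]

variable [Fintype ι]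

theorem derivation_det (D : Derivation R A A) (M : Matrix ι ι A) :
    D M.det = ∑ i, (M.updateRow i fun j => D (M i j)).det := by
  have hrow : ∀ N : Matrix ι ι A, N.det = ∑ σ : Equiv.Perm ι, σ.sign • ∏ i, N i (σ i) :=
    fun N => by rw [← Matrix.det_transpose, Matrix.det_apply]; rfl
  simp only [hrow, map_sum]
  rw [Finset.sum_comm]
  refine Finset.sum_congr rfl fun σ _ => ?_
  rw [Units.smul_def, map_zsmul, derivation_prod, Finset.smul_sum]
  refine Finset.sum_congr rfl fun i _ => ?_
  rw [Units.smul_def]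
  congr 1
  refine Finset.prod_congr rfl fun j _ => ?_
  rcases eq_or_ne j i with rfl | hj
  · simp
  · simp [hj]

theorem sum_det_updateRow_mul (M N : Matrix ι ι A) :
    ∑ i, (M.updateRow i ((M * N) i)).det = N.trace * M.det := by
  have h : ∀ i, (M.updateRow i ((M * N) i)).det = ((M * N) * M.adjugate) i i := by
    intro i
    rw [← Matrix.cramer_transpose_apply, Matrix.cramer_eq_adjugate_mulVec,
      ← Matrix.adjugate_transpose, Matrix.mulVec_transpose]
    rfl
  simp_rw [h]
  change Matrix.trace _ = _
  rw [Matrix.trace_mul_comm, ← Matrix.mul_assoc, Matrix.adjugate_mul, Matrix.smul_mul,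
    Matrix.one_mul, Matrix.trace_smul, smul_eq_mul, mul_comm]

end Determinant

variable {K : Type*} [Field K] {n : ℕ}

/-! ### Locally nilpotent vector fields have divergence zero -/

/-- The Jacobian determinant `det (∂ fᵢ / ∂ xⱼ)`, which is the coefficient of the top form
`df₁ ∧ ⋯ ∧ dfₙ`. -/
noncomputable def jacobian (f : Fin n → Poly K n) : Poly K n :=
  (Matrix.of fun i j => pderiv j (f i)).det

/-- The Lie derivative of the top form `df₁ ∧ ⋯ ∧ dfₙ`: along `D` the form `g dx₁ ∧ ⋯ ∧ dxₙ` goes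
to `(D g + div(D) g) dx₁ ∧ ⋯ ∧ dxₙ`. -/
theorem apply_jacobian_add (D : VF K n) (f : Fin n → Poly K n) :
    D (jacobian f) + divergence D * jacobian f =
      ∑ i, jacobian (Function.update f i (D (f i))) := by
  set M : Matrix (Fin n) (Fin n) (Poly K n) := Matrix.of fun i j => pderiv j (f i) with hM
  set N : Matrix (Fin n) (Fin n) (Poly K n) := Matrix.of fun k j => pderiv j (D (X k)) with hN
  have htr : divergence D = N.trace := rfl
  have hupd : ∀ i, jacobian (Function.update f i (D (f i))) =
      (M.updateRow i fun j => D (M i j)).det + (M.updateRow i ((M * N) i)).det := by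
    intro i
    rw [← Matrix.det_updateRow_add, jacobian]
    congr 1
    ext1 k j
    rcases eq_or_ne k i with rfl | hk
    · simp only [Matrix.of_apply, Function.update_self, Matrix.updateRow_self, Pi.add_apply,
        Matrix.mul_apply, hM, hN]
      rw [pderiv_comm_vf]
      congr 1
      exact Finset.sum_congr rfl fun _ _ => mul_comm _ _
    · simp [hk, hM]
  rw [Finset.sum_congr rfl fun i _ => hupd i, Finset.sum_add_distrib, ← derivation_det,
    sum_det_updateRow_mul, htr]
  rfl

theorem jacobian_X : jacobian (X : Fin n → Poly K n) = 1 := by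
  rw [jacobian, ← Matrix.det_one (n := Fin n)]
  congr 1
  ext1 i j
  rw [Matrix.of_apply, pderiv_X, Matrix.one_apply, Pi.single_apply]

theorem jacobian_eq_zero {f : Fin n → Poly K n} {i : Fin n} (h : f i = 0) : jacobian f = 0 :=
  Matrix.det_eq_zero_of_row_eq_zero i fun j => by simp [h]

/-- The operator `p ↦ D p + div(D) p`, the Lie derivative along `D` on top forms. -/
noncomputable def lieTop (D : VF K n) : Poly K n →ₗ[K] Poly K n :=
  D.toLinearMap + LinearMap.mulLeft K (divergence D)

theorem lieTop_apply (D : VF K n) (p : Poly K n) : lieTop D p = D p + divergence D * p := rfl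

/-- Each application of `lieTop D` to `jacobian f` replaces, term by term, one `fᵢ` by `D fᵢ`, which
lowers the sum of the exponents needed to kill the `fᵢ`. -/
theorem iterate_lieTop_jacobian (D : VF K n) (N : ℕ) (f : Fin n → Poly K n) (m : Fin n → ℕ)
    (hm : ∑ i, m i ≤ N) (hf : ∀ i, D^[m i] (f i) = 0) : (lieTop D)^[N + 1] (jacobian f) = 0 := by
  induction N generalizing f m with
  | zero =>
    have h0 : ∀ i, f i = 0 := fun i => by
      have : m i = 0 := by
        have := Finset.single_le_sum (fun j _ => Nat.zero_le (m j)) (Finset.mem_univ i)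
        omega
      simpa [this] using hf i
    rw [zero_add, Function.iterate_one, lieTop_apply, apply_jacobian_add]
    exact Finset.sum_eq_zero fun i _ => jacobian_eq_zero (i := i) (by simp [h0])
  | succ N ih =>
    rw [Function.iterate_succ_apply, lieTop_apply, apply_jacobian_add, ← Module.End.pow_apply,
      map_sum]
    refine Finset.sum_eq_zero fun i _ => ?_
    rw [Module.End.pow_apply]
    rcases Nat.eq_zero_or_pos (m i) with hi | hi
    · have hfi : f i = 0 := by simpa [hi] using hf i
      rw [jacobian_eq_zero (i := i) (by simp [hfi]), iterate_map_zero]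
    · refine ih _ (Function.update m i (m i - 1)) ?_ fun k => ?_
      · rw [Finset.sum_update_of_mem (Finset.mem_univ i)]
        rw [Finset.sum_eq_add_sum_sdiff_singleton_of_mem (Finset.mem_univ i)] at hm
        omega
      · rcases eq_or_ne k i with rfl | hk
        · rw [Function.update_self, Function.update_self, ← Function.iterate_succ_apply,
            Nat.succ_eq_add_one, Nat.sub_add_cancel hi]
          exact hf k
        · rw [Function.update_of_ne hk, Function.update_of_ne hk]
          exact hf k

/-- The Lie derivative along a locally nilpotent `D` acts locally nilpotently on the exact forms
`dxᵢ`, hence on the top form `dx₁ ∧ ⋯ ∧ dxₙ`; but `p ↦ D p + div(D) p` is injective unless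
`div(D) = 0`. -/
theorem divergence_eq_zero_of_locallyNilpotent [CharZero K] (D : VF K n)
    (hD : ∀ f, ∃ k, D^[k] f = 0) : divergence D = 0 := by
  by_contra hd
  choose m hm using fun i : Fin n => hD (X i)
  have h := iterate_lieTop_jacobian D _ X m le_rfl hm
  rw [jacobian_X] at h
  have hinj : Function.Injective (lieTop D) := by
    rw [← LinearMap.ker_eq_bot, LinearMap.ker_eq_bot']
    intro p hp
    rw [lieTop_apply] at hp
    refine (eq_zero_of_apply_eq_mul D hD (g := -divergence D) ?_).resolve_left (neg_ne_zero.mpr hd)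
    rw [neg_mul]
    exact eq_neg_of_add_eq_zero_left hp
  exact one_ne_zero (hinj.iterate _ (h.trans (iterate_map_zero _ _).symm))

/-! ### Elements with locally nilpotent adjoint action -/

/-- The elements `x` of a Lie algebra for which `ad x` is locally nilpotent. -/
def adNilpotents (L : Type*) [LieRing L] : Set L := {x | ∀ y : L, ∃ k, (fun z => ⁅x, z⁆)^[k] y = 0}

theorem mem_adNilpotents {L : Type*} [LieRing L] {x : L} :
    x ∈ adNilpotents L ↔ ∀ y : L, ∃ k, (fun z => ⁅x, z⁆)^[k] y = 0 := Iff.rfl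

theorem map_mem_adNilpotents {R L : Type*} [CommRing R] [LieRing L] [LieAlgebra R L]
    (φ : L ≃ₗ⁅R⁆ L) {x : L} (hx : x ∈ adNilpotents L) : φ x ∈ adNilpotents L := by
  rw [mem_adNilpotents] at hx ⊢
  intro y
  obtain ⟨k, hk⟩ := hx (φ.symm y)
  refine ⟨k, ?_⟩
  have h : Function.Semiconj φ (fun z => ⁅x, z⁆) (fun z => ⁅φ x, z⁆) := fun z => φ.map_lie x z
  have := (h.iterate_right k) (φ.symm y)
  rw [hk, map_zero, LieEquiv.apply_symm_apply] at this
  exact this.symm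

theorem smul_vf_apply (f : Poly K n) (D : VF K n) (p : Poly K n) : (f • D) p = f * D p := rfl

theorem vf_eq_sum_smul (D : VF K n) : D = ∑ i, D (X i) • (pderiv i : VF K n) := by
  refine Derivation.ext fun p => ?_
  rw [vf_eq_sum, ← Derivation.coeFnAddMonoidHom_apply (∑ i, _), map_sum, Finset.sum_apply]
  rfl

/-- The shear-type vector fields `u ∂ᵢ` with `∂u/∂xᵢ = 0`. -/
def shears (K : Type*) [Field K] (n : ℕ) : Set (VF K n) :=
  {D | ∃ (i : Fin n) (u : Poly K n), pderiv i u = 0 ∧ D = u • (pderiv i : VF K n)}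

theorem locallyNilpotent_of_mem_shears {D : VF K n} (hD : D ∈ shears K n) (f : Poly K n) :
    ∃ k, D^[k] f = 0 := by
  obtain ⟨i, u, hu, rfl⟩ := hD
  induction f using MvPolynomial.induction_on with
  | C a => exact ⟨1, by simp⟩
  | add p q hp hq =>
    obtain ⟨a, ha⟩ := hp
    obtain ⟨b, hb⟩ := hq
    refine ⟨a + b, ?_⟩
    rw [iterate_map_add, iterate_derivation_eq_zero_of_le _ ha (by omega),
      iterate_derivation_eq_zero_of_le _ hb (by omega), add_zero]
  | mul_X p j hp =>
    refine exists_iterate_mul_eq_zero _ hp ⟨2, ?_⟩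
    rcases eq_or_ne j i with rfl | hj
    · simp [hu]
    · simp [pderiv_X_of_ne hj]

/-- For `D = u ∂ᵢ` and `j ≠ i`, the component of `[D, E]` along `∂ⱼ` is `D` applied to that of `E`,
so iterating `ad D` kills these components first; what remains is of the form `b ∂ᵢ`, on which
`ad D` acts by
`b ↦ D b`. -/
theorem shears_subset_adNilpotents : shears K n ⊆ adNilpotents (VF K n) := by
  intro D hD
  rw [mem_adNilpotents]
  intro E
  have hnil := locallyNilpotent_of_mem_shears hD
  obtain ⟨i, u, hu, hDu⟩ := hD
  have hDX : ∀ j, j ≠ i → D (X j) = 0 := fun j hj => by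
    rw [hDu, smul_vf_apply, pderiv_X_of_ne hj, mul_zero]
  have hDi : D (X i) = u := by rw [hDu, smul_vf_apply, pderiv_X_self, mul_one]
  have h1 : ∀ k (F : VF K n) j, j ≠ i → ((fun z => ⁅D, z⁆)^[k] F) (X j) = D^[k] (F (X j)) := by
    intro k F j hj
    induction k with
    | zero => rfl
    | succ k ih =>
      rw [Function.iterate_succ_apply', Derivation.commutator_apply, hDX j hj, map_zero, sub_zero,
        ih, Function.iterate_succ_apply']
  have h2 : ∀ k (F : VF K n), (∀ j, j ≠ i → F (X j) = 0) →
      ((fun z => ⁅D, z⁆)^[k] F) (X i) = D^[k] (F (X i)) := by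
    intro k F hF
    induction k with
    | zero => rfl
    | succ k ih =>
      have hFu : ((fun z => ⁅D, z⁆)^[k] F) u = 0 := by
        rw [vf_eq_sum]
        refine Finset.sum_eq_zero fun j _ => ?_
        rcases eq_or_ne j i with rfl | hj
        · rw [hu, mul_zero]
        · rw [h1 k F j hj, hF j hj, iterate_map_zero, zero_mul]
      rw [Function.iterate_succ_apply', Derivation.commutator_apply, hDi, hFu, sub_zero, ih,
        Function.iterate_succ_apply']
  choose m hm using fun j => hnil (E (X j))
  obtain ⟨F, hF⟩ : ∃ F, F = (fun z => ⁅D, z⁆)^[∑ j, m j] E := ⟨_, rfl⟩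
  have hFj : ∀ j, j ≠ i → F (X j) = 0 := fun j hj => by
    rw [hF, h1 _ _ j hj]
    exact iterate_derivation_eq_zero_of_le D (hm j)
      (Finset.single_le_sum (fun j _ => Nat.zero_le (m j)) (Finset.mem_univ j))
  obtain ⟨k, hk⟩ := hnil (F (X i))
  refine ⟨k + ∑ j, m j, ?_⟩
  rw [Function.iterate_add_apply, ← hF]
  refine MvPolynomial.derivation_ext fun j => ?_
  rw [Derivation.zero_apply]
  rcases eq_or_ne j i with rfl | hj
  · rw [h2 k F hFj, hk]
  · rw [h1 k F j hj, hFj j hj, iterate_map_zero]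

theorem locallyNilpotent_of_mem_adNilpotents {D : VF K n} (hD : D ∈ adNilpotents (VF K n))
    (f : Poly K n) : ∃ k, D^[k] f = 0 := by
  rcases eq_or_ne D 0 with rfl | hne
  · exact ⟨1, rfl⟩
  -- `(ad D)^k (f D) = (D^k f) D`, because `D` commutes with itself.
  have h : ∀ k, (fun z => ⁅D, z⁆)^[k] (f • D) = (D^[k] f) • D := by
    intro k
    induction k with
    | zero => rfl
    | succ k ih =>
      rw [Function.iterate_succ_apply', ih, Function.iterate_succ_apply']
      refine Derivation.ext fun p => ?_
      simp only [Derivation.commutator_apply, smul_vf_apply, Derivation.leibniz, smul_eq_mul]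
      ring
  obtain ⟨k, hk⟩ := mem_adNilpotents.mp hD (f • D)
  rw [h] at hk
  refine ⟨k, by_contra fun hne' => hne (Derivation.ext fun p => ?_)⟩
  exact (mul_eq_zero.mp (congrArg (fun E : VF K n => E p) hk)).resolve_left hne'

/-! ### Vector fields of divergence zero -/

theorem divergence_add (D E : VF K n) : divergence (D + E) = divergence D + divergence E := by
  simp [divergence, Finset.sum_add_distrib]

theorem divergence_smul (c : K) (D : VF K n) : divergence (c • D) = c • divergence D := by
  simp [divergence, Finset.smul_sum]

theorem divergence_smul_pderiv (a : Poly K n) (i : Fin n) :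
    divergence (a • (pderiv i : VF K n)) = pderiv i a := by
  rw [divergence, Finset.sum_eq_single i]
  · simp [smul_vf_apply]
  · intro j _ hj
    simp [smul_vf_apply, pderiv_X_of_ne hj]
  · simp

/-- The divergence as a `K`-linear map. -/
noncomputable def divLin (K : Type*) [Field K] (n : ℕ) : VF K n →ₗ[K] Poly K n where
  toFun := divergence
  map_add' := divergence_add
  map_smul' := divergence_smul

theorem divLin_apply (D : VF K n) : divLin K n D = divergence D := rfl

/-- The Lie algebra of polynomial vector fields of divergence zero. -/
noncomputable def divZero (K : Type*) [Field K] (n : ℕ) : LieSubalgebra K (VF K n) where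
  __ := LinearMap.ker (divLin K n)
  lie_mem' := by
    intro D E hD hE
    have hD' : divergence D = 0 := hD
    have hE' : divergence E = 0 := hE
    change divergence _ = 0
    rw [divergence_lie, hD', hE', map_zero, map_zero, sub_zero]

theorem mem_divZero {D : VF K n} : D ∈ divZero K n ↔ divergence D = 0 := Iff.rfl

theorem divZero_le_divC : divZero K n ≤ divC K n := fun D hD =>
  mem_divC.mpr ⟨0, by rw [mem_divZero.mp hD, map_zero]⟩

theorem exists_pderiv_eq [CharZero K] (i : Fin n) (p : Poly K n) : ∃ q, pderiv i q = p := by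
  induction p using MvPolynomial.induction_on' with
  | monomial s c =>
    refine ⟨monomial (s + Finsupp.single i 1) (c / (s i + 1)), ?_⟩
    have : (s i + 1 : K) ≠ 0 := by exact_mod_cast Nat.succ_ne_zero (s i)
    rw [pderiv_monomial, add_tsub_cancel_right]
    congr 1
    simp [this]
  | add p q hp hq =>
    obtain ⟨a, rfl⟩ := hp
    obtain ⟨b, rfl⟩ := hq
    exact ⟨a + b, map_add _ _ _⟩

theorem exists_divergence_eq [CharZero K] (i : Fin n) (p : Poly K n) :
    ∃ D : VF K n, divergence D = p := by
  obtain ⟨q, rfl⟩ := exists_pderiv_eq i p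
  exact ⟨q • (pderiv i : VF K n), divergence_smul_pderiv q i⟩

theorem lieSpan_shears_le_divZero : LieSubalgebra.lieSpan K (VF K n) (shears K n) ≤ divZero K n :=
  LieSubalgebra.lieSpan_le.mpr fun D hD => by
    obtain ⟨i, u, hu, rfl⟩ := hD
    exact mem_divZero.mpr (by rw [divergence_smul_pderiv, hu])

/-- Every `a ∂ᵢ` can be completed by a multiple of `∂ⱼ` to an element of the Lie algebra generated
by the shears. For a monomial `a = u w`, with `u` a power of `xᵢ` and `w` free of `xᵢ`, take `v`
free of `xᵢ` with `∂v/∂xⱼ = w`; then `[u ∂ⱼ, v ∂ᵢ] = u w ∂ᵢ - v (∂u/∂xᵢ) ∂ⱼ`. -/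
theorem exists_add_mem_lieSpan_shears [CharZero K] {i j : Fin n} (hij : i ≠ j) (a : Poly K n) :
    ∃ b : Poly K n, a • (pderiv i : VF K n) + b • (pderiv j : VF K n) ∈
      LieSubalgebra.lieSpan K (VF K n) (shears K n) := by
  induction a using MvPolynomial.induction_on' with
  | monomial s c =>
    set t : Fin n →₀ ℕ := s.erase i with ht
    have hti : t i = 0 := by simp [ht]
    have htj : t j = s j := by simp [ht, hij.symm]
    set u : Poly K n := monomial (Finsupp.single i (s i)) 1 with hu
    set v : Poly K n := monomial (t + Finsupp.single j 1) (c / (s j + 1)) with hv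
    have huj : pderiv j u = 0 := by simp [hu, pderiv_monomial, hij]
    have hvi : pderiv i v = 0 := by simp [hv, pderiv_monomial, hti, hij.symm]
    have hvj : u * pderiv j v = monomial s c := by
      have : (s j + 1 : K) ≠ 0 := by exact_mod_cast Nat.succ_ne_zero (s j)
      rw [hv, pderiv_monomial, add_tsub_cancel_right, hu, monomial_mul, ht,
        Finsupp.single_add_erase]
      congr 1
      simp [this, hij.symm]
    refine ⟨-(v * pderiv i u), ?_⟩
    have hmem := (LieSubalgebra.lieSpan K (VF K n) (shears K n)).lie_mem
      (LieSubalgebra.subset_lieSpan ⟨j, u, huj, rfl⟩)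
      (LieSubalgebra.subset_lieSpan ⟨i, v, hvi, rfl⟩)
    convert hmem using 1
    refine MvPolynomial.derivation_ext fun k => ?_
    simp only [Derivation.commutator_apply, Derivation.add_apply, smul_vf_apply,
      Derivation.leibniz, smul_eq_mul, ← hvj]
    have hXk : ∀ l m : Fin n, pderiv l (pderiv m (X k : Poly K n)) = 0 := fun l m => by
      rw [pderiv_X, Pi.single_apply]
      split_ifs <;> simp
    simp only [hXk]
    ring
  | add p q hp hq =>
    obtain ⟨a, ha⟩ := hp
    obtain ⟨b, hb⟩ := hq
    refine ⟨a + b, ?_⟩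
    rw [add_smul, add_smul, add_add_add_comm]
    exact add_mem ha hb

theorem lieSpan_shears [CharZero K] :
    LieSubalgebra.lieSpan K (VF K n) (shears K n) = divZero K n := by
  refine le_antisymm lieSpan_shears_le_divZero fun D hD => ?_
  rcases n with _ | n
  · rw [vf_eq_sum_smul D, Finset.univ_eq_empty, Finset.sum_empty]
    exact zero_mem _
  choose! b hb using fun (i : Fin (n + 1)) (hi : i ≠ 0) =>
    exists_add_mem_lieSpan_shears hi (D (X i))
  set E := ∑ i ∈ Finset.univ.erase (0 : Fin (n + 1)),
    (D (X i) • (pderiv i : VF K (n + 1)) + b i • (pderiv 0 : VF K (n + 1))) with hE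
  have hEmem : E ∈ LieSubalgebra.lieSpan K (VF K (n + 1)) (shears K (n + 1)) :=
    sum_mem fun i hi => hb i (Finset.ne_of_mem_erase hi)
  -- What is left of `D` is a multiple `c ∂₀` of divergence zero, that is, a shear.
  set c := D (X 0) - ∑ i ∈ Finset.univ.erase (0 : Fin (n + 1)), b i with hc
  have hDE : D = c • (pderiv 0 : VF K (n + 1)) + E := by
    conv_lhs => rw [vf_eq_sum_smul D, ← Finset.add_sum_erase _ _ (Finset.mem_univ 0)]
    rw [hE, Finset.sum_add_distrib, ← Finset.sum_smul, add_left_comm, ← add_smul, hc,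
      sub_add_cancel]
    exact add_comm _ _
  have hcdiv : pderiv 0 c = 0 := by
    have h := mem_divZero.mp hD
    rwa [hDE, divergence_add, mem_divZero.mp (lieSpan_shears_le_divZero hEmem), add_zero,
      divergence_smul_pderiv] at h
  rw [hDE]
  exact add_mem (LieSubalgebra.subset_lieSpan ⟨0, c, hcdiv, rfl⟩) hEmem

theorem lieSpan_adNilpotents [CharZero K] :
    LieSubalgebra.lieSpan K (VF K n) (adNilpotents (VF K n)) = divZero K n := by
  refine le_antisymm (LieSubalgebra.lieSpan_le.mpr fun D hD => ?_) ?_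
  · exact mem_divZero.mpr (divergence_eq_zero_of_locallyNilpotent D
      (locallyNilpotent_of_mem_adNilpotents hD))
  · rw [← lieSpan_shears]
    exact LieSubalgebra.lieSpan_mono shears_subset_adNilpotents

theorem map_mem_divZero [CharZero K] (φ : VF K n ≃ₗ⁅K⁆ VF K n) {D : VF K n}
    (hD : D ∈ divZero K n) : φ D ∈ divZero K n := by
  rw [← lieSpan_adNilpotents] at hD ⊢
  have h : LieSubalgebra.lieSpan K (VF K n) (adNilpotents (VF K n)) ≤
      (LieSubalgebra.lieSpan K (VF K n) (adNilpotents (VF K n))).comap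
        (φ : VF K n →ₗ⁅K⁆ VF K n) :=
    LieSubalgebra.lieSpan_le.mpr fun E hE =>
      LieSubalgebra.subset_lieSpan (map_mem_adNilpotents φ hE)
  exact h hD

/-! ### Invariance under automorphisms -/

theorem eq_C_of_forall_pderiv_eq_zero [CharZero K] {p : Poly K n} (h : ∀ i, pderiv i p = 0) :
    ∃ c, p = C c := by
  refine ⟨coeff 0 p, MvPolynomial.ext _ _ fun m => ?_⟩
  rw [coeff_C]
  split_ifs with hm
  · rw [hm]
  · obtain ⟨i, hi⟩ := Finsupp.ne_iff.mp (Ne.symm hm)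
    have hle : Finsupp.single i 1 ≤ m :=
      Finsupp.single_le_iff.mpr (Nat.one_le_iff_ne_zero.mpr hi)
    have hco := coeff_pderiv (i := i) p (m - Finsupp.single i 1)
    rw [h i, coeff_zero, tsub_add_cancel_of_le hle] at hco
    refine (mul_eq_zero.mp hco.symm).resolve_right ?_
    exact Nat.cast_add_one_ne_zero _

/-- `divC` is the normalizer of `divZero`. -/
theorem mem_divC_iff_normalizes [CharZero K] {D : VF K n} :
    D ∈ divC K n ↔ ∀ E ∈ divZero K n, ⁅D, E⁆ ∈ divZero K n := by
  constructor
  · rintro ⟨c, hc⟩ E hE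
    rw [mem_divZero] at hE ⊢
    rw [divergence_lie, hE, hc, map_zero, ← MvPolynomial.algebraMap_eq, Derivation.map_algebraMap,
      sub_zero]
  · intro h
    refine eq_C_of_forall_pderiv_eq_zero fun i => ?_
    have hi : divergence (pderiv i : VF K n) = 0 := by
      simpa using divergence_smul_pderiv (1 : Poly K n) i
    have := mem_divZero.mp (h _ (mem_divZero.mpr hi))
    rwa [divergence_lie, hi, map_zero, zero_sub, neg_eq_zero] at this

theorem map_mem_divC [CharZero K] (φ : VF K n ≃ₗ⁅K⁆ VF K n) {D : VF K n}
    (hD : D ∈ divC K n) : φ D ∈ divC K n := by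
  rw [mem_divC_iff_normalizes] at hD ⊢
  intro E hE
  have h := map_mem_divZero φ (hD _ (map_mem_divZero φ.symm hE))
  rwa [LieEquiv.map_lie, LieEquiv.apply_symm_apply] at h

theorem map_divC [CharZero K] (φ : VF K n ≃ₗ⁅K⁆ VF K n) :
    (divC K n).map (φ : VF K n →ₗ⁅K⁆ VF K n) = divC K n := by
  refine le_antisymm ?_ fun D hD => ?_
  · rintro _ ⟨D, hD, rfl⟩
    exact map_mem_divC φ hD
  · exact ⟨φ.symm D, map_mem_divC φ.symm hD, φ.apply_symm_apply D⟩

/-! ### Simplicity and maximality -/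

theorem totalDegree_pderiv_lt {i : Fin n} {p : Poly K n} (h : pderiv i p ≠ 0) :
    (pderiv i p).totalDegree < p.totalDegree := by
  obtain ⟨m, hm, hdeg⟩ := Finset.exists_mem_eq_sup _ (support_nonempty.mpr h)
    fun s : Fin n →₀ ℕ => s.sum fun _ e => e
  change (pderiv i p).totalDegree = _ at hdeg
  have hp : m + Finsupp.single i 1 ∈ p.support := by
    rw [mem_support_iff, coeff_pderiv] at hm
    exact mem_support_iff.mpr (left_ne_zero_of_mul hm)
  have := le_totalDegree hp
  rw [hdeg]
  rw [Finsupp.sum_add_index' (fun _ => rfl) (fun _ _ _ => rfl)] at this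
  simpa using this

/-- A subspace of `P_n` stable under all vector fields of divergence zero is `P_n` as soon as it
contains a nonconstant polynomial: differentiate down to degree one, and use that `D xⱼ` is
arbitrary for `D` of divergence zero. -/
theorem eq_top_of_stable [CharZero K] (hn : 2 ≤ n) (W : Submodule K (Poly K n))
    (hW : ∀ D ∈ divZero K n, ∀ p ∈ W, D p ∈ W) {p : Poly K n} (hp : p ∈ W)
    (hpc : ∀ c, p ≠ C c) : W = ⊤ := by
  induction hd : p.totalDegree using Nat.strong_induction_on generalizing p with
  | _ d ih =>
    have hshear : ∀ (i : Fin n) (u : Poly K n), pderiv i u = 0 →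
        ∀ q ∈ W, u * pderiv i q ∈ W := fun i u hu q hq =>
      hW (u • (pderiv i : VF K n)) (mem_divZero.mpr (by rw [divergence_smul_pderiv, hu])) q hq
    by_cases hconst : ∀ i, ∃ c, pderiv i p = C c
    · obtain ⟨i, hi⟩ : ∃ i, pderiv i p ≠ 0 := by
        by_contra! h0
        obtain ⟨c, hc⟩ := eq_C_of_forall_pderiv_eq_zero h0
        exact hpc c hc
      obtain ⟨c, hc⟩ := hconst i
      have hc0 : c ≠ 0 := by
        rintro rfl
        exact hi (by rw [hc, map_zero])
      have : Nontrivial (Fin n) := Fin.nontrivial_iff_two_le.mpr hn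
      obtain ⟨j, hji⟩ := exists_ne i
      have hXj : (X j : Poly K n) ∈ W := by
        have h := hshear i (X j) (pderiv_X_of_ne hji) p hp
        rw [hc, mul_comm, ← smul_eq_C_mul] at h
        exact (W.smul_mem_iff hc0).mp h
      refine eq_top_iff.mpr fun a _ => ?_
      obtain ⟨b, hb⟩ := exists_add_mem_lieSpan_shears hji a
      have h := hW _ (lieSpan_shears_le_divZero hb) _ hXj
      simpa [smul_vf_apply, pderiv_X_of_ne hji] using h
    · push Not at hconst
      obtain ⟨i, hi⟩ := hconst
      have hne : pderiv i p ≠ 0 := by simpa using hi 0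
      refine ih _ (hd ▸ totalDegree_pderiv_lt hne) ?_ hi rfl
      simpa using hshear i 1 pderiv_one p hp

theorem X_ne_C (i : Fin n) (c : K) : (X i : Poly K n) ≠ C c := fun h => by
  have := congrArg (pderiv i) h
  simp at this

theorem isIrreducible_quotient_constants [CharZero K] (hn : 2 ≤ n) :
    LieModule.IsIrreducible K (divC K n) (Poly K n ⧸ constants K n) := by
  have hmk : ∀ p : Poly K n, LieSubmodule.Quotient.mk' (constants K n) p = 0 ↔
      ∃ c, p = C c := fun p => by
    rw [LieSubmodule.Quotient.mk_eq_zero]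
    exact ⟨fun ⟨c, hc⟩ => ⟨c, hc.symm⟩, fun ⟨c, hc⟩ => ⟨c, hc.symm⟩⟩
  have : Nontrivial (Poly K n ⧸ constants K n) := by
    refine ⟨LieSubmodule.Quotient.mk' (constants K n) (X ⟨0, by omega⟩), 0, fun h => ?_⟩
    obtain ⟨c, hc⟩ := (hmk _).mp h
    exact X_ne_C _ c hc
  refine LieModule.IsIrreducible.mk fun N hN => ?_
  obtain ⟨x, hxN, hx0⟩ : ∃ x ∈ N, x ≠ 0 := by
    by_contra! h
    exact hN ((LieSubmodule.eq_bot_iff N).mpr h)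
  obtain ⟨p, rfl⟩ := LieSubmodule.Quotient.surjective_mk' (constants K n) x
  let W : Submodule K (Poly K n) :=
    (N : Submodule K (Poly K n ⧸ constants K n)).comap
      (LieSubmodule.Quotient.mk' (constants K n) : Poly K n →ₗ[K] Poly K n ⧸ constants K n)
  have hWtop : W = ⊤ := by
    refine eq_top_of_stable hn W (fun D hD q hq => ?_) (p := p) hxN
      fun c hc => hx0 ((hmk p).mpr ⟨c, hc⟩)
    exact N.lie_mem (x := ⟨D, divZero_le_divC hD⟩) hq
  refine eq_top_iff.mpr fun y _ => ?_
  obtain ⟨q, rfl⟩ := LieSubmodule.Quotient.surjective_mk' (constants K n) y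
  have hq : q ∈ W := hWtop ▸ Submodule.mem_top
  exact hq

theorem divC_ne_top [CharZero K] (i : Fin n) : divC K n ≠ ⊤ := fun h => by
  obtain ⟨D, hD⟩ := exists_divergence_eq i (X i : Poly K n)
  obtain ⟨c, hc⟩ := mem_divC.mp (h ▸ LieSubalgebra.mem_top D)
  exact X_ne_C i c (hD.symm.trans hc)

theorem isCoatom_divC [CharZero K] (hn : 2 ≤ n) : IsCoatom (divC K n) := by
  refine ⟨divC_ne_top ⟨0, by omega⟩, fun M hM => ?_⟩
  obtain ⟨hle, D, hDM, hD⟩ := SetLike.lt_iff_le_and_exists.mp hM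
  -- The divergences of the elements of `M` form a stable subspace, as `div [E, F] = E (div F)`
  -- for `E` of divergence zero.
  have htop : (M : Submodule K (VF K n)).map (divLin K n) = ⊤ := by
    refine eq_top_of_stable hn _ ?_ (Submodule.mem_map_of_mem hDM)
      fun c hc => hD (mem_divC.mpr ⟨c, hc⟩)
    rintro E hE _ ⟨F, hF, rfl⟩
    refine ⟨⁅E, F⁆, M.lie_mem (hle (divZero_le_divC hE)) hF, ?_⟩
    rw [divLin_apply, divergence_lie, mem_divZero.mp hE, map_zero, sub_zero, divLin_apply]
  refine eq_top_iff.mpr fun E _ => ?_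
  obtain ⟨F, hF, hFE⟩ : divergence E ∈ (M : Submodule K (VF K n)).map (divLin K n) :=
    htop ▸ Submodule.mem_top
  have hEF : E - F ∈ divZero K n := by
    change divLin K n (E - F) = 0
    rw [map_sub, hFE, divLin_apply, sub_self]
  rw [← sub_add_cancel E F]
  exact add_mem (hle (divZero_le_divC hEF)) hF

/-! ### One variable -/

theorem vf_one_apply (D : VF K 1) (p : Poly K 1) : D p = D (X 0) * pderiv 0 p := by
  rw [vf_eq_sum, Fin.sum_univ_one]

/-- The vector fields `a ∂` on the line with `a''' = 0`, a copy of `𝔰𝔩₂` in characteristic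
zero. -/
noncomputable def quadraticVF (K : Type*) [Field K] : LieSubalgebra K (VF K 1) where
  carrier := {D | pderiv 0 (pderiv 0 (pderiv 0 (D (X 0)))) = 0}
  add_mem' := by
    intro D E hD hE
    simp only [Set.mem_ofPred_eq] at hD hE ⊢
    simp [hD, hE]
  zero_mem' := by simp
  smul_mem' := by
    intro c D hD
    simp only [Set.mem_ofPred_eq] at hD ⊢
    simp [hD]
  lie_mem' := by
    intro D E hD hE
    simp only [Set.mem_ofPred_eq] at hD hE ⊢
    rw [Derivation.commutator_apply, vf_one_apply D (E _), vf_one_apply E (D _)]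
    simp only [map_sub, map_add, Derivation.leibniz, smul_eq_mul, hD, hE, map_zero]
    ring

theorem mem_quadraticVF {D : VF K 1} :
    D ∈ quadraticVF K ↔ pderiv 0 (pderiv 0 (pderiv 0 (D (X 0)))) = 0 := Iff.rfl

theorem not_isCoatom_divC_one [CharZero K] : ¬ IsCoatom (divC K 1) := by
  intro h
  have hlt : divC K 1 < quadraticVF K := by
    refine SetLike.lt_iff_le_and_exists.mpr
      ⟨fun D hD => ?_, (X 0 ^ 2 : Poly K 1) • (pderiv 0 : VF K 1), ?_, ?_⟩
    · obtain ⟨c, hc⟩ := mem_divC.mp hD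
      rw [divergence, Fin.sum_univ_one] at hc
      rw [mem_quadraticVF, hc, pderiv_C, map_zero]
    · rw [mem_quadraticVF]
      simp [smul_vf_apply, pow_two]
    · rintro ⟨c, hc⟩
      rw [divergence_smul_pderiv] at hc
      have := congrArg (pderiv 0) hc
      simp [pow_two, one_add_one_eq_two] at this
  have htop := h.2 _ hlt
  have hmem : (X 0 ^ 3 : Poly K 1) • (pderiv 0 : VF K 1) ∈ quadraticVF K :=
    htop ▸ LieSubalgebra.mem_top _
  rw [mem_quadraticVF] at hmem
  simp [smul_vf_apply, pow_succ] at hmem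
  norm_num at hmem

end PolyVF

theorem mainTheorem5 (K : Type*) [Field K] [CharZero K] (n : ℕ) :
    (2 ≤ n →
      LieModule.IsIrreducible K (PolyVF.divC K n) (PolyVF.Poly K n ⧸ PolyVF.constants K n) ∧
      IsCoatom (PolyVF.divC K n)) ∧
    (n = 1 → ¬ IsCoatom (PolyVF.divC K n)) ∧
    (∀ φ : PolyVF.VF K n ≃ₗ⁅K⁆ PolyVF.VF K n,
      (PolyVF.divC K n).map (φ : PolyVF.VF K n →ₗ⁅K⁆ PolyVF.VF K n) = PolyVF.divC K n) ∧
    (∀ σ : PolyVF.Poly K n ≃ₐ[K] PolyVF.Poly K n,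
      (PolyVF.divC K n).map (PolyVF.conj σ : PolyVF.VF K n →ₗ⁅K⁆ PolyVF.VF K n) =
        PolyVF.divC K n) := by
  refine ⟨fun hn => ⟨PolyVF.isIrreducible_quotient_constants hn, PolyVF.isCoatom_divC hn⟩, ?_,
    PolyVF.map_divC, fun σ => PolyVF.map_divC (PolyVF.conj σ)⟩
  rintro rfl
  exact PolyVF.not_isCoatom_divC_one
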